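/- For positive integers $a,b$ let $E_{a,b}$ be the curve $y^2=x^3-a^2x+b^2$ over $\mathbb{Q}$. Call $(a,b)$ admissible if $a,b$ are coprime positive integers with $b$ odd, $3\mid b$ and $4\nmid a$. (1) For every admissible pair $(a,b)$, $E_{a,b}$ is an elliptic curve and the torsion subgroup of $E_{a,b}(\mathbb{Q})$ is trivial. (2) There are infinitely many admissible pairs $(a,b)$ with $a^2=3b^2+1$. (3) For every admissible pair $(a,b)$ with $a^2=3b^2+1$, the points $(0,b)$, $(a,b)$, $(-1,2b)$ lie on $E_{a,b}$ and are $\mathbb{Z}$-linearly independent in $E_{a,b}(\mathbb{Q})$; in particular the rank of $E_{a,b}(\mathbb{Q})$ is at least $3$. (4) For every integer $\ell\ge 0$ there are nonnegative integers $a,b$ with $(2+\sqrt3)^{3+6\ell}=a+b\sqrt3$, and a pair $(a,b)$ of nonnegative integers is admissible with $a^2=3b^2+1$ if and only if it arises in this way for some integer $\ell\ge0$. -/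

import Mathlib

/-- The Weierstrass curve `y² = x³ - a²x + b²` over `ℚ`. -/
def curveE (a b : ℕ) : WeierstrassCurve ℚ where
  a₁ := 0
  a₂ := 0
  a₃ := 0
  a₄ := -(a : ℚ) ^ 2
  a₆ := (b : ℚ) ^ 2

/-- Coprime positive integers `a`, `b` with `b` odd, `3 ∣ b` and `4 ∤ a`. -/
def Admissible (a b : ℕ) : Prop :=
  0 < a ∧ 0 < b ∧ Nat.Coprime a b ∧ Odd b ∧ 3 ∣ b ∧ ¬ 4 ∣ a

/-!
Everything rests on explicit formulas for `2P` and `3P`, on the absolute value at the prime `3`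
and on the signs of `x`-coordinates.

*Torsion.* The curve reduces modulo `3` to `y² = x³ - x`, which has good reduction and whose four
points are killed by `2`. Hence `2P` is the origin or reduces to the origin modulo `3`, that is,
`x(2P)` is not integral at `3` (`Admissible.reducesToOrigin_double`). On nonzero points reducing to
the origin, tripling multiplies the absolute value at `3` of the `x`-coordinate by `9`
(`Admissible.padicNorm_triple`), so for `2P ≠ 0` the points `3 ^ k • 2P` are pairwise distinct
and `2P` has infinite order. It remains to exclude points of order two, that is, rational roots of
`x³ - a²x + b²`; this is a coprimality argument modulo `8`, the only place where `4 ∤ a` matters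
for the torsion (`Admissible.cubic_int_ne_zero`).

*Independence.* Without `2`-torsion it is enough that no sum over a nonempty subset of the three
points `P₁ = (0, b)`, `P₂ = (a, b)`, `P₃ = (-1, 2b)` is a double
(`linearIndependent_int_of_not_double`). The `x`-coordinate of a nonzero double is not integral at
`3`, and it is positive when `a² = 3b² + 1` (`double_x_pos`). All subset sums except `P₂ + P₃` have
an `x`-coordinate integral at `3`; for `P₁ + P₂ + P₃` this uses `a ≡ 2 mod 3`. The `x`-coordinate
of `P₂ + P₃` is negative. In other words, the homomorphism
`E(ℚ) → E(𝔽₃) × π₀(E(ℝ)) ≅ (ℤ/2)³` separates the subset sums.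

*Pell's equation.* The solutions of `a² = 3b² + 1` are given by the powers of `2 + √3`, and modulo
`6` the sequence of the `b`s has period `6` and takes the value `3` exactly at the indices
`3 + 6l`. The condition `4 ∤ a` is automatic for odd `b`.
-/

/-! ### Pell's equation -/

theorem xn_two_add (m n : ℕ) : Pell.xn one_lt_two (m + n) =
    Pell.xn one_lt_two m * Pell.xn one_lt_two n
      + 3 * Pell.yn one_lt_two m * Pell.yn one_lt_two n :=
  Pell.xn_add one_lt_two m n

theorem two_add_sqrt_three_pow (n : ℕ) :
    (2 + Real.sqrt 3) ^ n =
      (Pell.xn one_lt_two n : ℝ) + (Pell.yn one_lt_two n : ℝ) * Real.sqrt 3 := by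
  induction n with
  | zero => simp
  | succ n ih =>
    have hs : Real.sqrt 3 * Real.sqrt 3 = 3 := Real.mul_self_sqrt (by norm_num)
    rw [pow_succ, ih, Pell.yn_succ, xn_two_add, Pell.xn_one, Pell.yn_one]
    push_cast
    linear_combination (Pell.yn one_lt_two n : ℝ) * hs

theorem natCast_add_mul_sqrt_three_inj {a b c d : ℕ}
    (h : (a : ℝ) + b * Real.sqrt 3 = c + d * Real.sqrt 3) : a = c ∧ b = d := by
  have hirr : Irrational (Real.sqrt 3) := by
    simpa using Nat.Prime.irrational_sqrt Nat.prime_three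
  have hbd : b = d := by
    by_contra hne
    have hne' : ((b : ℤ) - d) ≠ 0 := sub_ne_zero.2 (by exact_mod_cast hne)
    refine (hirr.intCast_mul hne').ne_int ((c : ℤ) - a) ?_
    push_cast
    linear_combination h
  subst hbd
  exact ⟨by exact_mod_cast add_right_cancel h, rfl⟩

theorem pell_three_iff {a b : ℕ} :
    a ^ 2 = 3 * b ^ 2 + 1 ↔ ∃ n, a = Pell.xn one_lt_two n ∧ b = Pell.yn one_lt_two n := by
  constructor
  · intro h
    refine Pell.eq_pell one_lt_two (show a * a - 3 * b * b = 1 from ?_)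
    rw [← sq, h, mul_assoc, ← sq]
    omega
  · rintro ⟨n, rfl, rfl⟩
    have h : Pell.xn one_lt_two n * Pell.xn one_lt_two n
        - 3 * Pell.yn one_lt_two n * Pell.yn one_lt_two n = 1 := Pell.pell_eq one_lt_two n
    rw [mul_assoc, ← sq, ← sq] at h
    omega

/-- Multiplication by `(2 + √3) ^ 6 = 1351 + 780 √3` is the identity modulo `6`, so the residues
modulo `6` of the Pell sequences only depend on the index modulo `6`. -/
theorem pell_three_mod_six (r l : ℕ) :
    Pell.xn one_lt_two (r + 6 * l) % 6 = Pell.xn one_lt_two r % 6 ∧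
      Pell.yn one_lt_two (r + 6 * l) % 6 = Pell.yn one_lt_two r % 6 := by
  induction l with
  | zero => simp
  | succ l ih =>
    have hx : Pell.xn one_lt_two 6 = 1351 := by decide
    have hy : Pell.yn one_lt_two 6 = 780 := by decide
    have e : r + 6 * (l + 1) = (r + 6 * l) + 6 := by ring
    rw [e, xn_two_add (r + 6 * l), Pell.yn_add _ (r + 6 * l), hx, hy]
    omega

theorem admissible_pell_iff {a b : ℕ} :
    (Admissible a b ∧ a ^ 2 = 3 * b ^ 2 + 1) ↔
      ∃ l, a = Pell.xn one_lt_two (3 + 6 * l) ∧ b = Pell.yn one_lt_two (3 + 6 * l) := by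
  constructor
  · rintro ⟨⟨-, -, -, hodd, hthree, -⟩, h⟩
    obtain ⟨n, rfl, rfl⟩ := pell_three_iff.1 h
    have hmod := (pell_three_mod_six (n % 6) (n / 6)).2
    rw [Nat.mod_add_div] at hmod
    have hn : n % 6 = 3 := by
      have h6 : n % 6 < 6 := Nat.mod_lt _ (by norm_num)
      have h2 := Nat.odd_iff.1 hodd
      generalize n % 6 = r at hmod h6
      -- modulo `6` the sequence of the `b`s runs through `0, 1, 4, 3, 2, 5`
      have e0 : Pell.yn one_lt_two 0 = 0 := by decide
      have e1 : Pell.yn one_lt_two 1 = 1 := by decide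
      have e2 : Pell.yn one_lt_two 2 = 4 := by decide
      have e3 : Pell.yn one_lt_two 3 = 15 := by decide
      have e4 : Pell.yn one_lt_two 4 = 56 := by decide
      have e5 : Pell.yn one_lt_two 5 = 209 := by decide
      interval_cases r <;> omega
    refine ⟨n / 6, ?_, ?_⟩ <;> rw [← hn, Nat.mod_add_div]
  · rintro ⟨l, ha, hb⟩
    have h : a ^ 2 = 3 * b ^ 2 + 1 := pell_three_iff.2 ⟨_, ha, hb⟩
    have hmod := (pell_three_mod_six 3 l).2
    have e3 : Pell.yn one_lt_two 3 = 15 := by decide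
    rw [← hb, e3] at hmod
    have hodd : Odd b := Nat.odd_iff.2 (by omega)
    refine ⟨⟨?_, by omega, ?_, hodd, by omega, ?_⟩, h⟩
    · rw [ha]
      exact Pell.x_pos _ _
    · rw [ha, hb]
      exact Pell.xy_coprime _ _
    · rintro ⟨c, rfl⟩
      obtain ⟨k, rfl⟩ := hodd
      obtain ⟨j, hj⟩ := Nat.even_mul_succ_self k
      have : 4 * c ^ 2 = 6 * j + 1 := by linarith
      omega

theorem mod_three_of_admissible_pell {a b : ℕ} (hab : Admissible a b)
    (h : a ^ 2 = 3 * b ^ 2 + 1) : a % 3 = 2 := by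
  obtain ⟨l, ha, -⟩ := admissible_pell_iff.1 ⟨hab, h⟩
  have hmod := (pell_three_mod_six 3 l).1
  have e3 : Pell.xn one_lt_two 3 = 26 := by decide
  rw [← ha, e3] at hmod
  omega

theorem infinite_admissible_pell :
    {p : ℕ × ℕ | Admissible p.1 p.2 ∧ p.1 ^ 2 = 3 * p.2 ^ 2 + 1}.Infinite := by
  refine Set.infinite_of_injective_forall_mem
    (f := fun l : ℕ => (Pell.xn one_lt_two (3 + 6 * l), Pell.yn one_lt_two (3 + 6 * l))) ?_
    fun l => admissible_pell_iff.2 ⟨l, rfl, rfl⟩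
  intro l m hlm
  have := (Pell.strictMono_x one_lt_two).injective (Prod.ext_iff.1 hlm).1
  omega

/-! ### Independence modulo doubles -/

/-- In an abelian group without `2`-torsion, elements whose images in `G / 2G` are linearly
independent over the field with two elements are linearly independent over `ℤ`: a nontrivial
relation could be halved until some coefficient is odd. -/
theorem linearIndependent_int_of_not_double {ι G : Type*} [Fintype ι] [AddCommGroup G]
    (htors : ∀ P : G, P + P = 0 → P = 0) (v : ι → G)
    (hv : ∀ c : ι → ℤ, (∀ i, c i = 0 ∨ c i = 1) → (∃ i, c i = 1) →
      ∀ R : G, R + R ≠ ∑ i, c i • v i) :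
    LinearIndependent ℤ v := by
  have heven : ∀ g : ι → ℤ, ∑ i, g i • v i = 0 → ∀ i, 2 ∣ g i := by
    intro g hg
    by_contra! hodd
    obtain ⟨i, hi⟩ := hodd
    refine hv (fun i => g i % 2) (fun i => Int.emod_two_eq_zero_or_one _) ⟨i, by omega⟩
      (-∑ i, (g i / 2) • v i) ?_
    have hsplit : ∑ i, g i • v i
        = ∑ i, (g i % 2) • v i + (∑ i, (g i / 2) • v i + ∑ i, (g i / 2) • v i) := by
      rw [← Finset.sum_add_distrib, ← Finset.sum_add_distrib]
      refine Finset.sum_congr rfl fun i _ => ?_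
      rw [← add_smul, ← add_smul]
      congr 1
      omega
    rw [hg] at hsplit
    rw [← neg_add]
    exact (eq_neg_of_add_eq_zero_left hsplit.symm).symm
  have hpow : ∀ k : ℕ, ∀ g : ι → ℤ, ∑ i, g i • v i = 0 → ∀ i, 2 ^ k ∣ g i := by
    intro k
    induction k with
    | zero => simp
    | succ k ih =>
      intro g hg i
      choose f hf using heven g hg
      have hf0 : ∑ i, f i • v i = 0 := by
        apply htors
        rw [← hg, ← Finset.sum_add_distrib]
        refine Finset.sum_congr rfl fun i _ => ?_
        rw [← add_smul, hf i, two_mul]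
      rw [hf i, pow_succ']
      exact mul_dvd_mul_left 2 (ih f hf0 i)
  rw [Fintype.linearIndependent_iff]
  intro g hg i
  refine Int.eq_zero_of_abs_lt_dvd (hpow (g i).natAbs g hg i) ?_
  rw [Int.abs_eq_natAbs]
  exact_mod_cast Nat.lt_two_pow_self

theorem linearIndependent_int_three_of_not_double {G : Type*} [AddCommGroup G]
    (htors : ∀ P : G, P + P = 0 → P = 0) {P Q S : G} (hP : ∀ R, R + R ≠ P)
    (hQ : ∀ R, R + R ≠ Q) (hS : ∀ R, R + R ≠ S) (hPQ : ∀ R, R + R ≠ P + Q)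
    (hPS : ∀ R, R + R ≠ P + S) (hQS : ∀ R, R + R ≠ Q + S)
    (hPQS : ∀ R, R + R ≠ P + Q + S) : LinearIndependent ℤ ![P, Q, S] := by
  refine linearIndependent_int_of_not_double htors _ ?_
  intro c hc ⟨i, hi⟩ R
  rw [Fin.sum_univ_three]
  simp only [Matrix.cons_val_zero, Matrix.cons_val_one, Matrix.cons_val]
  rcases hc 0 with h0 | h0 <;> rcases hc 1 with h1 | h1 <;> rcases hc 2 with h2 | h2 <;>
    simp only [h0, h1, h2, zero_smul, one_smul, zero_add, add_zero]
  · fin_cases i <;> simp_all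
  · exact hS R
  · exact hQ R
  · exact hQS R
  · exact hP R
  · exact hPS R
  · exact hPQ R
  · exact hPQS R

/-! ### The defining cubic and the discriminant -/

/-- The cubic `x³ - a²x + b²` has no integral root: a root `n` and the cofactor `a² - n²` are
coprime with product `b²`, so `n` is plus or minus an odd square, but the equation
forces `a ≡ 2 mod 4` and then `n ≡ 3 mod 8`. -/
theorem Admissible.cubic_int_ne_zero {a b : ℕ} (hab : Admissible a b) (n : ℤ) :
    n ^ 3 - (a : ℤ) ^ 2 * n + (b : ℤ) ^ 2 ≠ 0 := by
  obtain ⟨-, -, hcop, ⟨k, hk⟩, -, h4⟩ := hab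
  intro h0
  have hmul : n * ((a : ℤ) ^ 2 - n ^ 2) = (b : ℤ) ^ 2 := by linear_combination -h0
  have hna : IsCoprime n (a : ℤ) :=
    (((Nat.isCoprime_iff_coprime.2 hcop).pow_right (n := 2)).symm).of_isCoprime_of_dvd_left
      ⟨_, hmul.symm⟩
  have hcop' : IsCoprime n ((a : ℤ) ^ 2 - n ^ 2) := by
    have := (hna.pow_right (n := 2)).add_mul_left_right (-n)
    rwa [show (a : ℤ) ^ 2 + n * -n = (a : ℤ) ^ 2 - n ^ 2 by ring] at this
  have hb8 : (b : ZMod 8) ^ 2 = 1 := by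
    rw [hk]
    push_cast
    generalize (k : ZMod 8) = t
    revert t
    decide
  have h8 : (n : ZMod 8) * ((a : ZMod 8) ^ 2 - (n : ZMod 8) ^ 2) = 1 := by
    rw [← hb8]
    exact_mod_cast congrArg (Int.cast : ℤ → ZMod 8) hmul
  have ha4 : (a : ZMod 8) ≠ 0 ∧ (a : ZMod 8) ≠ 4 := by
    constructor
    · intro h
      have := (ZMod.natCast_eq_zero_iff a 8).1 h
      omega
    · intro h
      have := (ZMod.natCast_eq_natCast_iff' a 4 8).1 (by exact_mod_cast h)
      omega
  have hnsq : ∃ t : ZMod 8, (n : ZMod 8) = t ^ 2 ∨ (n : ZMod 8) = -t ^ 2 := by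
    obtain ⟨t, ht | ht⟩ := Int.sq_of_isCoprime hcop' hmul
    · exact ⟨t, Or.inl (by rw [ht]; push_cast; rfl)⟩
    · exact ⟨t, Or.inr (by rw [ht]; push_cast; rfl)⟩
  obtain ⟨t, ht⟩ := hnsq
  generalize (n : ZMod 8) = n' at h8 ht
  generalize (a : ZMod 8) = a' at h8 ha4
  revert n' a' t
  decide

theorem Admissible.cubic_ne_zero {a b : ℕ} (hab : Admissible a b) (x : ℚ) :
    x ^ 3 - (a : ℚ) ^ 2 * x + (b : ℚ) ^ 2 ≠ 0 := by
  intro h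
  have hint : IsIntegral ℤ x := by
    refine ⟨Polynomial.X ^ 3 + (Polynomial.C (-(a : ℤ) ^ 2) * Polynomial.X
      + Polynomial.C ((b : ℤ) ^ 2)), ?_, ?_⟩
    · exact Polynomial.monic_X_pow_add
        (lt_of_le_of_lt Polynomial.degree_linear_le (by norm_num))
    · simp only [Polynomial.eval₂_add, Polynomial.eval₂_mul, Polynomial.eval₂_pow,
        Polynomial.eval₂_X, Polynomial.eval₂_C]
      simp
      linear_combination h
  obtain ⟨n, rfl⟩ := IsIntegrallyClosed.isIntegral_iff.1 hint
  refine hab.cubic_int_ne_zero n ?_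
  simp only [eq_intCast] at h
  exact_mod_cast h

theorem Admissible.not_three_dvd {a b : ℕ} (hab : Admissible a b) : ¬ 3 ∣ a := fun h =>
  Nat.not_coprime_of_dvd_of_dvd (by norm_num) h hab.2.2.2.2.1 hab.2.2.1

/-- The discriminant is `16 (4 a⁶ - 27 b⁴)`, which is nonzero because `3 ∤ a`. -/
theorem Admissible.isElliptic {a b : ℕ} (hab : Admissible a b) : (curveE a b).IsElliptic := by
  refine ⟨isUnit_iff_ne_zero.2 fun h => ?_⟩
  have h' : (4 * a ^ 6 : ℚ) = 27 * b ^ 4 := by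
    simp only [WeierstrassCurve.Δ, WeierstrassCurve.b₂, WeierstrassCurve.b₄,
      WeierstrassCurve.b₆, WeierstrassCurve.b₈, curveE] at h
    linear_combination h / 16
  have h'' : 4 * a ^ 6 = 27 * b ^ 4 := by exact_mod_cast h'
  have h3 : 3 ∣ 4 * a ^ 6 := ⟨9 * b ^ 4, by rw [h'']; ring⟩
  exact hab.not_three_dvd (Nat.prime_three.dvd_of_dvd_pow
    ((Nat.Coprime.dvd_mul_left (by norm_num)).1 h3))

/-! ### Explicit addition on the curve -/

theorem curveE_equation_iff {a b : ℕ} {x y : ℚ} :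
    (curveE a b).toAffine.Equation x y ↔ y ^ 2 = x ^ 3 - (a : ℚ) ^ 2 * x + (b : ℚ) ^ 2 := by
  rw [WeierstrassCurve.Affine.equation_iff]
  simp only [curveE]
  ring_nf

theorem Admissible.nonsingular {a b : ℕ} (hab : Admissible a b) {x y : ℚ}
    (h : y ^ 2 = x ^ 3 - (a : ℚ) ^ 2 * x + (b : ℚ) ^ 2) :
    (curveE a b).toAffine.Nonsingular x y :=
  haveI := hab.isElliptic
  WeierstrassCurve.Affine.equation_iff_nonsingular.1 (curveE_equation_iff.2 h)

theorem Admissible.y_ne_zero {a b : ℕ} (hab : Admissible a b) {x y : ℚ}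
    (h : (curveE a b).toAffine.Nonsingular x y) : y ≠ 0 := by
  rintro rfl
  have h' := curveE_equation_iff.1 h.1
  exact hab.cubic_ne_zero x (by linear_combination -h')

open WeierstrassCurve.Affine (Point)

theorem curveE_add_of_X_ne {a b : ℕ} {x₁ y₁ x₂ y₂ : ℚ}
    (h₁ : (curveE a b).toAffine.Nonsingular x₁ y₁) (h₂ : (curveE a b).toAffine.Nonsingular x₂ y₂)
    (hx : x₁ ≠ x₂) {x y : ℚ} (hx' : ((y₁ - y₂) / (x₁ - x₂)) ^ 2 - x₁ - x₂ = x)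
    (hy' : (y₁ - y₂) / (x₁ - x₂) * (x₁ - x) - y₁ = y) :
    ∃ h, Point.some x₁ y₁ h₁ + Point.some x₂ y₂ h₂ = Point.some x y h := by
  have hX : (curveE a b).toAffine.addX x₁ x₂ ((curveE a b).toAffine.slope x₁ x₂ y₁ y₂) = x := by
    rw [WeierstrassCurve.Affine.slope_of_X_ne hx, ← hx', WeierstrassCurve.Affine.addX]
    simp only [curveE]
    ring
  have hY : (curveE a b).toAffine.addY x₁ x₂ y₁
      ((curveE a b).toAffine.slope x₁ x₂ y₁ y₂) = y := by
    rw [WeierstrassCurve.Affine.addY, WeierstrassCurve.Affine.negAddY, hX,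
      WeierstrassCurve.Affine.slope_of_X_ne hx, ← hy', WeierstrassCurve.Affine.negY]
    simp only [curveE]
    ring
  have hadd := Point.add_of_X_ne (h₁ := h₁) (h₂ := h₂) hx
  subst hX hY
  exact ⟨_, hadd⟩

theorem curveE_double {a b : ℕ} {x y : ℚ} (h : (curveE a b).toAffine.Nonsingular x y)
    (hy : y ≠ 0) {ℓ x' y' : ℚ} (hℓ : (3 * x ^ 2 - (a : ℚ) ^ 2) / (2 * y) = ℓ)
    (hx' : ℓ ^ 2 - 2 * x = x') (hy' : ℓ * (x - x') - y = y') :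
    ∃ h', Point.some x y h + Point.some x y h = Point.some x' y' h' := by
  have hne : y ≠ (curveE a b).toAffine.negY x y := by
    rw [WeierstrassCurve.Affine.negY]
    simp only [curveE]
    intro h0
    exact hy (by linarith)
  have hs : (curveE a b).toAffine.slope x x y y = ℓ := by
    rw [WeierstrassCurve.Affine.slope_of_Y_ne rfl hne, ← hℓ, WeierstrassCurve.Affine.negY]
    simp only [curveE]
    congr 1 <;> ring
  have hX : (curveE a b).toAffine.addX x x ((curveE a b).toAffine.slope x x y y) = x' := by
    rw [hs, ← hx', WeierstrassCurve.Affine.addX]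
    simp only [curveE]
    ring
  have hY : (curveE a b).toAffine.addY x x y ((curveE a b).toAffine.slope x x y y) = y' := by
    rw [WeierstrassCurve.Affine.addY, WeierstrassCurve.Affine.negAddY, hX, hs, ← hy',
      WeierstrassCurve.Affine.negY]
    simp only [curveE]
    ring
  have hadd := Point.add_self_of_Y_ne (h₁ := h) hne
  subst hX hY
  exact ⟨_, hadd⟩

theorem Admissible.eq_zero_of_add_self {a b : ℕ} (hab : Admissible a b)
    (P : (curveE a b).toAffine.Point) (hP : P + P = 0) : P = 0 := by
  rcases P with _ | ⟨x, y, h⟩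
  · rfl
  · obtain ⟨h', e⟩ := curveE_double h (hab.y_ne_zero h) rfl rfl rfl
    exact absurd (e.symm.trans hP) (Point.some_ne_zero h')

/-- The tripling formula: with the third division polynomial
`ψ = 3x⁴ - 6a²x² + 12b²x - a⁴`, one has `x(2P) - x(P) = -ψ / (4y²)`. -/
theorem curveE_triple {a b : ℕ} {x y ψ : ℚ} (h : (curveE a b).toAffine.Nonsingular x y)
    (hy : y ≠ 0) (hψ : 3 * x ^ 4 - 6 * (a : ℚ) ^ 2 * x ^ 2 + 12 * (b : ℚ) ^ 2 * x
      - (a : ℚ) ^ 4 = ψ) (hψ0 : ψ ≠ 0) :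
    ∃ y' h', Point.some x y h + Point.some x y h + Point.some x y h =
      Point.some (x + 8 * y ^ 2 * (8 * y ^ 4 - (3 * x ^ 2 - (a : ℚ) ^ 2) * ψ) / ψ ^ 2) y' h' := by
  have heq := curveE_equation_iff.1 h.1
  obtain ⟨ℓ, hℓ⟩ : ∃ ℓ, (3 * x ^ 2 - (a : ℚ) ^ 2) / (2 * y) = ℓ := ⟨_, rfl⟩
  have hm : 3 * x ^ 2 - (a : ℚ) ^ 2 = 2 * y * ℓ := by
    rw [← hℓ]
    field_simp
  obtain ⟨x₂, hx₂⟩ : ∃ x₂, ℓ ^ 2 - 2 * x = x₂ := ⟨_, rfl⟩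
  obtain ⟨h₂, e⟩ := curveE_double h hy hℓ hx₂ rfl
  have hdiff : x₂ - x = -ψ / (4 * y ^ 2) := by
    rw [eq_div_iff (by positivity), ← hψ, ← hx₂]
    linear_combination (-(2 * y * ℓ) - (3 * x ^ 2 - (a : ℚ) ^ 2)) * hm - 12 * x * heq
  have hne : x₂ - x ≠ 0 := by
    rw [hdiff]
    exact div_ne_zero (neg_ne_zero.2 hψ0) (by positivity)
  -- the chord through `P` and `2P` has slope `8y³/ψ - ℓ`
  have hslope : (ℓ * (x - x₂) - y - y) / (x₂ - x) = 8 * y ^ 3 / ψ - ℓ := by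
    rw [div_eq_iff hne]
    have : 8 * y ^ 3 / ψ * (x₂ - x) = -2 * y := by
      rw [hdiff]
      field_simp
      ring
    linear_combination -this
  have hx₃ : ((ℓ * (x - x₂) - y - y) / (x₂ - x)) ^ 2 - x₂ - x =
      x + 8 * y ^ 2 * (8 * y ^ 4 - (3 * x ^ 2 - (a : ℚ) ^ 2) * ψ) / ψ ^ 2 := by
    rw [hslope, hm, ← hx₂]
    field_simp
    ring
  obtain ⟨h₃, e₃⟩ := curveE_add_of_X_ne h₂ h (sub_ne_zero.1 hne) hx₃ rfl
  exact ⟨_, h₃, by rw [e, e₃]⟩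

/-! ### Arithmetic at the prime three -/

/-- The subring of `ℚ` of rational numbers that are integral at `3`. -/
def integralAtThree : Subring ℚ where
  carrier := {x | padicNorm 3 x ≤ 1}
  mul_mem' {x y} hx hy := by
    rw [Set.mem_ofPred_eq, padicNorm.mul]
    exact mul_le_one₀ hx (padicNorm.nonneg y) hy
  one_mem' := by simp
  add_mem' {x y} hx hy := padicNorm.nonarchimedean.trans (max_le hx hy)
  zero_mem' := by simp
  neg_mem' {x} hx := by simpa using hx

theorem mem_integralAtThree {x : ℚ} : x ∈ integralAtThree ↔ padicNorm 3 x ≤ 1 := Iff.rfl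

theorem coe_ofNat_integralAtThree (n : ℕ) [n.AtLeastTwo] :
    ((no_index (OfNat.ofNat n) : integralAtThree) : ℚ) = OfNat.ofNat n := rfl

theorem padicNorm_three_three : padicNorm 3 3 = 1 / 3 := by
  simpa using padicNorm.padicNorm_p (p := 3) (by norm_num)

theorem padicNorm_one_add_three_mul (c : integralAtThree) :
    padicNorm 3 (1 + 3 * (c : ℚ)) = 1 := by
  have hc : padicNorm 3 (3 * (c : ℚ)) ≤ 1 / 3 := by
    rw [padicNorm.mul, padicNorm_three_three]
    have := mem_integralAtThree.1 c.2
    linarith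
  rw [padicNorm.add_eq_max_of_ne, padicNorm.one, max_eq_left]
  · linarith
  · rw [padicNorm.one]
    intro h
    linarith

/-- A rational number which is not integral at `3` is the inverse of `3w` with `w` integral
at `3`. -/
theorem exists_eq_inv_three_mul {x : ℚ} (hx : 1 < padicNorm 3 x) :
    ∃ w : integralAtThree, (w : ℚ) ≠ 0 ∧ x = (3 * (w : ℚ))⁻¹ := by
  have hx0 : x ≠ 0 := by
    rintro rfl
    simp at hx
    linarith
  have h3 : 3 ≤ padicNorm 3 x := by
    obtain ⟨z, hz⟩ := padicNorm.values_discrete (p := 3) hx0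
    rw [hz] at hx ⊢
    have hz1 : 0 < -z := (one_lt_zpow_iff_right₀ (by norm_num)).1 hx
    calc (3 : ℚ) = ((3 : ℕ) : ℚ) ^ (1 : ℤ) := by norm_num
      _ ≤ _ := zpow_le_zpow_right₀ (by norm_num) hz1
  refine ⟨⟨(3 * x)⁻¹, ?_⟩, ?_, ?_⟩
  · rw [mem_integralAtThree, inv_eq_one_div, padicNorm.div, padicNorm.mul,
      padicNorm_three_three, padicNorm.one]
    rw [div_le_one (by linarith)]
    linarith
  · simpa using hx0
  · simp only
    field_simp

/-- Fermat's little theorem at the prime `3`: the reduction of `x³ - x` vanishes. -/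
theorem padicNorm_cube_sub_self_lt {x : ℚ} (hx : padicNorm 3 x ≤ 1) :
    padicNorm 3 (x ^ 3 - x) < 1 := by
  have hden : ¬ 3 ∣ x.den := by
    intro hd
    have hnum : padicNorm 3 (x.num : ℚ) < 1 := by
      have hmul : (x.num : ℚ) = x * x.den := (Rat.mul_den_eq_num x).symm
      rw [hmul, padicNorm.mul]
      have := (padicNorm.nat_lt_one_iff (p := 3) x.den).2 hd
      nlinarith [padicNorm.nonneg (p := 3) x, padicNorm.nonneg (p := 3) (x.den : ℚ)]
    have h3 := (padicNorm.int_lt_one_iff (p := 3) x.num).1 hnum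
    exact Nat.not_coprime_of_dvd_of_dvd (by norm_num) (Int.natCast_dvd.1 h3) hd x.reduced
  have hd1 : padicNorm 3 (x.den : ℚ) = 1 := (padicNorm.nat_eq_one_iff _).2 hden
  have hint : (3 : ℤ) ∣ x.num ^ 3 - x.num * (x.den : ℤ) ^ 2 := by
    refine (ZMod.intCast_zmod_eq_zero_iff_dvd _ 3).1 ?_
    have hdz : (x.den : ZMod 3) ≠ 0 := fun h => hden ((ZMod.natCast_eq_zero_iff _ 3).1 h)
    push_cast
    generalize (x.den : ZMod 3) = d at hdz
    generalize (x.num : ZMod 3) = n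
    revert n d
    decide
  have hlt := (padicNorm.int_lt_one_iff (p := 3) _).2 hint
  have hmul : ((x.num ^ 3 - x.num * (x.den : ℤ) ^ 2 : ℤ) : ℚ)
      = (x ^ 3 - x) * (x.den * x.den * x.den) := by
    push_cast
    rw [← Rat.mul_den_eq_num x]
    ring
  rw [hmul, padicNorm.mul, padicNorm.mul, padicNorm.mul, hd1, mul_one, mul_one, mul_one] at hlt
  exact hlt

theorem padicNorm_three_two : padicNorm 3 2 = 1 := by
  have := (padicNorm.nat_eq_one_iff (p := 3) 2).2 (by norm_num)
  exact_mod_cast this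

theorem padicNorm_pow (x : ℚ) (n : ℕ) : padicNorm 3 (x ^ n) = padicNorm 3 x ^ n := by
  induction n with
  | zero => simp
  | succ n ih => rw [pow_succ, padicNorm.mul, ih, pow_succ]

/-! ### The points that reduce to the origin modulo three -/

/-- The condition that a rational point, other than the origin, reduces to the origin modulo `3`:
its `x`-coordinate is not integral at `3`. -/
def ReducesToOrigin {a b : ℕ} (P : (curveE a b).toAffine.Point) : Prop :=
  ∃ x y h, P = .some x y h ∧ 1 < padicNorm 3 x

/-- Modulo `3` the curve is `y² = x³ - x`, all of whose points are killed by `2`. If the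
`x`-coordinate of `P` is integral at `3`, then `3 ∣ y` while `3 ∤ 3x² - a²`, so the tangent at `P`
has a slope that is not integral at `3`. Otherwise `x(2P)` and `x(P)` have the same absolute
value at `3`. -/
theorem Admissible.one_lt_padicNorm_double {a b : ℕ} (hab : Admissible a b) {x y : ℚ}
    (hy : y ≠ 0) (heq : y ^ 2 = x ^ 3 - (a : ℚ) ^ 2 * x + (b : ℚ) ^ 2) :
    1 < padicNorm 3 (((3 * x ^ 2 - (a : ℚ) ^ 2) / (2 * y)) ^ 2 - 2 * x) := by
  rcases lt_or_ge 1 (padicNorm 3 x) with hx | hx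
  · obtain ⟨w, hw0, rfl⟩ := exists_eq_inv_three_mul hx
    set u : ℚ := (3 * (w : ℚ))⁻¹ with hu
    have hu0 : u ≠ 0 := by positivity
    have hmul : (((3 * u ^ 2 - (a : ℚ) ^ 2) / (2 * y)) ^ 2 - 2 * u)
          * (4 * (1 + 3 * ((-(3 * a ^ 2 * w ^ 2) + 9 * b ^ 2 * w ^ 3 : integralAtThree) : ℚ))) =
        u * (1 + 3 * ((6 * a ^ 2 * w ^ 2 - 72 * b ^ 2 * w ^ 3 + 27 * a ^ 4 * w ^ 4 :
          integralAtThree) : ℚ)) := by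
      have hw : (w : ℚ) = 1 / (3 * u) := by
        rw [hu]
        field_simp
      have e1 : (1 + 3 * ((-(3 * a ^ 2 * w ^ 2) + 9 * b ^ 2 * w ^ 3 : integralAtThree) : ℚ))
          = y ^ 2 / u ^ 3 := by
        push_cast
        simp only [coe_ofNat_integralAtThree]
        rw [hw, heq]
        field_simp
        ring
      rw [e1]
      push_cast
      simp only [coe_ofNat_integralAtThree]
      rw [hw]
      field_simp
      linear_combination (-864 * u) * heq
    have hn := congrArg (padicNorm 3) hmul
    have h4 : padicNorm 3 4 = 1 := by
      have := (padicNorm.nat_eq_one_iff (p := 3) 4).2 (by norm_num)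
      exact_mod_cast this
    rw [padicNorm.mul, padicNorm.mul, padicNorm.mul, padicNorm_one_add_three_mul,
      padicNorm_one_add_three_mul, h4, mul_one, mul_one, mul_one] at hn
    rwa [hn]
  · have ha1 : padicNorm 3 (a : ℚ) = 1 := (padicNorm.nat_eq_one_iff _).2 hab.not_three_dvd
    have hx1 : padicNorm 3 (x ^ 2) ≤ 1 := by
      rw [padicNorm_pow]
      exact pow_le_one₀ (padicNorm.nonneg _) hx
    have hylt : padicNorm 3 y < 1 := by
      have hy2 : padicNorm 3 (y ^ 2) < 1 := by
        -- `y² = (x³ - x) + x (1 - a²) + b²`, where every summand vanishes modulo `3`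
        have hca : padicNorm 3 (1 - (a : ℚ) ^ 2) < 1 := by
          have := padicNorm_cube_sub_self_lt (x := (a : ℚ)) ha1.le
          rw [show (a : ℚ) ^ 3 - a = -(a * (1 - (a : ℚ) ^ 2)) by ring, padicNorm.neg,
            padicNorm.mul, ha1, one_mul] at this
          exact this
        have hxa : padicNorm 3 (x * (1 - (a : ℚ) ^ 2)) < 1 := by
          rw [padicNorm.mul]
          nlinarith [padicNorm.nonneg (p := 3) x,
            padicNorm.nonneg (p := 3) (1 - (a : ℚ) ^ 2)]
        have hb : padicNorm 3 ((b : ℚ) ^ 2) < 1 := by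
          rw [padicNorm_pow]
          exact pow_lt_one₀ (padicNorm.nonneg _)
            ((padicNorm.nat_lt_one_iff _).2 hab.2.2.2.2.1) two_ne_zero
        rw [show y ^ 2 = (x ^ 3 - x) + (x * (1 - (a : ℚ) ^ 2) + (b : ℚ) ^ 2) by
          rw [heq]; ring]
        exact padicNorm.nonarchimedean.trans_lt (max_lt (padicNorm_cube_sub_self_lt hx)
          (padicNorm.nonarchimedean.trans_lt (max_lt hxa hb)))
      rw [padicNorm_pow] at hy2
      exact lt_of_pow_lt_pow_left₀ 2 zero_le_one (by simpa using hy2)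
    have hm : padicNorm 3 (3 * x ^ 2 - (a : ℚ) ^ 2) = 1 := by
      have h1 : padicNorm 3 (3 * x ^ 2) ≤ 1 / 3 := by
        rw [padicNorm.mul, padicNorm_three_three]
        linarith
      have h2 : padicNorm 3 (-(a : ℚ) ^ 2) = 1 := by
        rw [padicNorm.neg, padicNorm_pow, ha1, one_pow]
      rw [sub_eq_add_neg, padicNorm.add_eq_max_of_ne, h2, max_eq_right]
      · linarith
      · rw [h2]
        intro h
        linarith
    have hy0 : 0 < padicNorm 3 y :=
      lt_of_le_of_ne (padicNorm.nonneg _) (padicNorm.nonzero hy).symm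
    have hℓ : 1 < padicNorm 3 (((3 * x ^ 2 - (a : ℚ) ^ 2) / (2 * y)) ^ 2) := by
      rw [padicNorm_pow, padicNorm.div, padicNorm.mul, hm, padicNorm_three_two, one_mul]
      exact one_lt_pow₀ ((one_lt_div hy0).2 hylt) two_ne_zero
    have h2x : padicNorm 3 (-(2 * x)) ≤ 1 := by
      rw [padicNorm.neg, padicNorm.mul, padicNorm_three_two, one_mul]
      exact hx
    rw [sub_eq_add_neg, padicNorm.add_eq_max_of_ne]
    · exact lt_max_of_lt_left hℓ
    · intro h
      linarith

theorem Admissible.reducesToOrigin_double {a b : ℕ} (hab : Admissible a b)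
    {P : (curveE a b).toAffine.Point} (hP : P ≠ 0) : ReducesToOrigin (P + P) := by
  rcases P with _ | ⟨x, y, h⟩
  · exact absurd rfl hP
  · have hy := hab.y_ne_zero h
    obtain ⟨h', e⟩ := curveE_double h hy rfl rfl rfl
    exact ⟨_, _, h', e, hab.one_lt_padicNorm_double hy (curveE_equation_iff.1 h.1)⟩

/-- Tripling is contracting on the points reducing to the origin modulo `3`: it multiplies
the absolute value at `3` of the `x`-coordinate by `9`, because there the third division
polynomial `ψ` is `3x⁴` and `x(3P) ψ²` is `x⁹`, both up to factors congruent to `1` modulo `3`. -/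
theorem Admissible.padicNorm_triple {a b : ℕ} (hab : Admissible a b) {x y : ℚ}
    (h : (curveE a b).toAffine.Nonsingular x y) (hx : 1 < padicNorm 3 x) :
    ∃ x' y' h', (3 : ℕ) • Point.some x y h = Point.some x' y' h' ∧
      padicNorm 3 x' = 9 * padicNorm 3 x := by
  have hy := hab.y_ne_zero h
  have heq := curveE_equation_iff.1 h.1
  obtain ⟨w, hw0, hxw⟩ := exists_eq_inv_three_mul hx
  have hx0 : x ≠ 0 := by
    rw [hxw]
    positivity
  have hw : (w : ℚ) = 1 / (3 * x) := by
    rw [hxw]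
    field_simp
  let c : integralAtThree := -(6 * a ^ 2 * w ^ 2) + 36 * b ^ 2 * w ^ 3 - 9 * a ^ 4 * w ^ 4
  let d : integralAtThree := -(3 * a ^ 2 * w ^ 2) + 9 * b ^ 2 * w ^ 3
  let e : integralAtThree := -(a ^ 2 * w ^ 2)
  let f : integralAtThree := 21 + 64 * (3 * d + 9 * d ^ 2 + 9 * d ^ 3) + 3 * (1 + 3 * c) ^ 2
    - 24 * (1 + 3 * d) * (1 + 3 * c) * (1 + 3 * e)
  obtain ⟨ψ, hψ⟩ : ∃ ψ, 3 * x ^ 4 - 6 * (a : ℚ) ^ 2 * x ^ 2 + 12 * (b : ℚ) ^ 2 * x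
      - (a : ℚ) ^ 4 = ψ := ⟨_, rfl⟩
  have hc : ψ = 3 * x ^ 4 * (1 + 3 * (c : ℚ)) := by
    simp only [c]
    push_cast
    simp only [coe_ofNat_integralAtThree]
    rw [hw, ← hψ]
    field_simp
    ring
  have hd : y ^ 2 = x ^ 3 * (1 + 3 * (d : ℚ)) := by
    simp only [d]
    push_cast
    simp only [coe_ofNat_integralAtThree]
    rw [hw, heq]
    field_simp
    ring
  have he : 3 * x ^ 2 - (a : ℚ) ^ 2 = 3 * x ^ 2 * (1 + 3 * (e : ℚ)) := by
    simp only [e]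
    push_cast
    rw [hw]
    field_simp
    ring
  have hnorm : padicNorm 3 ψ = 1 / 3 * padicNorm 3 x ^ 4 := by
    rw [hc, padicNorm.mul, padicNorm.mul, padicNorm_one_add_three_mul, padicNorm_three_three,
      padicNorm_pow, mul_one]
  have hψ0 : ψ ≠ 0 := by
    intro h0
    rw [h0, padicNorm.zero] at hnorm
    have : 0 < padicNorm 3 x ^ 4 := by positivity
    linarith
  obtain ⟨y', h', hP⟩ := curveE_triple h hy hψ hψ0
  refine ⟨_, y', h', ?_, ?_⟩
  · rw [← hP, succ_nsmul, two_nsmul]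
  · have hmul : (x + 8 * y ^ 2 * (8 * y ^ 4 - (3 * x ^ 2 - (a : ℚ) ^ 2) * ψ) / ψ ^ 2) * ψ ^ 2
        = x ^ 9 * (1 + 3 * (f : ℚ)) := by
      rw [add_mul, div_mul_cancel₀ _ (pow_ne_zero 2 hψ0), he,
        show y ^ 4 = (y ^ 2) ^ 2 by ring, hd, hc]
      simp only [f]
      push_cast
      simp only [coe_ofNat_integralAtThree]
      ring
    have hn := congrArg (padicNorm 3) hmul
    rw [padicNorm.mul, padicNorm.mul, padicNorm_one_add_three_mul, padicNorm_pow,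
      padicNorm_pow, hnorm, mul_one] at hn
    have h8 : 0 < padicNorm 3 x ^ 8 := by positivity
    refine mul_right_cancel₀ h8.ne' ?_
    linear_combination 9 * hn

theorem Admissible.injective_three_pow_smul {a b : ℕ} (hab : Admissible a b)
    {P : (curveE a b).toAffine.Point} (hP : ReducesToOrigin P) :
    Function.Injective fun k : ℕ => 3 ^ k • P := by
  obtain ⟨x, y, h, rfl, hx⟩ := hP
  have hpow : ∀ k : ℕ, ∃ x' y' h', (3 ^ k) • Point.some x y h = Point.some x' y' h' ∧
      padicNorm 3 x' = 9 ^ k * padicNorm 3 x := by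
    intro k
    induction k with
    | zero => exact ⟨x, y, h, by simp, by simp⟩
    | succ k ih =>
      obtain ⟨x', y', h', e, hn⟩ := ih
      have hx' : 1 < padicNorm 3 x' := by
        rw [hn]
        exact one_lt_mul_of_le_of_lt (one_le_pow₀ (by norm_num)) hx
      obtain ⟨x'', y'', h'', e', hn'⟩ := hab.padicNorm_triple h' hx'
      refine ⟨x'', y'', h'', ?_, ?_⟩
      · rw [pow_succ', mul_nsmul', e, e']
      · rw [hn', hn]
        ring
  intro k l hkl
  obtain ⟨x₁, y₁, h₁, e₁, hn₁⟩ := hpow k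
  obtain ⟨x₂, y₂, h₂, e₂, hn₂⟩ := hpow l
  have hkl' : Point.some x₁ y₁ h₁ = Point.some x₂ y₂ h₂ := e₁.symm.trans (hkl.trans e₂)
  have hx₁₂ := (Point.some.inj hkl').1
  rw [hx₁₂, hn₂] at hn₁
  have hx0 : padicNorm 3 x ≠ 0 := by positivity
  exact (pow_right_injective₀ (by norm_num : (0 : ℚ) < 9) (by norm_num)
    (mul_right_cancel₀ hx0 hn₁)).symm

/-- If `P ≠ 0` is torsion, then the points `3 ^ k • 2P` are torsion too, but they are pairwise
distinct multiples of `2P`. -/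
theorem Admissible.torsion_eq_bot {a b : ℕ} (hab : Admissible a b) :
    AddCommGroup.torsion (curveE a b).toAffine.Point = ⊥ := by
  rw [eq_bot_iff]
  intro P hP
  rw [AddSubgroup.mem_bot]
  by_contra hP0
  have hfin : IsOfFinAddOrder (P + P) :=
    (AddCommGroup.torsion (curveE a b).toAffine.Point).add_mem hP hP
  have hinj := hab.injective_three_pow_smul (hab.reducesToOrigin_double hP0)
  have hmult : (AddSubmonoid.multiples (P + P) : Set (curveE a b).toAffine.Point).Finite :=
    finite_multiples.2 hfin
  exact Set.infinite_of_injective_forall_mem hinj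
    (fun k => (AddSubmonoid.mem_multiples_iff _ _).2 ⟨3 ^ k, rfl⟩) hmult

/-! ### Independence of the three points -/

/-- When `a² = 3b² + 1`, the numerator `(x² + a²)² - 8b²x` of `4y² x(2P)` is positive. -/
theorem double_x_pos {a b : ℕ} (h : a ^ 2 = 3 * b ^ 2 + 1) (ha : 2 ≤ a) {x y : ℚ} (hy : y ≠ 0)
    (heq : y ^ 2 = x ^ 3 - (a : ℚ) ^ 2 * x + (b : ℚ) ^ 2) :
    0 < ((3 * x ^ 2 - (a : ℚ) ^ 2) / (2 * y)) ^ 2 - 2 * x := by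
  have hq : (a : ℚ) ^ 2 = 3 * b ^ 2 + 1 := by exact_mod_cast h
  have ha' : (2 : ℚ) ≤ a := by exact_mod_cast ha
  have e : ((3 * x ^ 2 - (a : ℚ) ^ 2) / (2 * y)) ^ 2 - 2 * x =
      ((x ^ 2 + (a : ℚ) ^ 2) ^ 2 - 8 * b ^ 2 * x) / (4 * y ^ 2) := by
    field_simp
    linear_combination (-32 * x) * heq
  rw [e]
  refine div_pos ?_ (by positivity)
  rcases le_or_gt x 0 with hx | hx
  · have h1 : 0 < (x ^ 2 + (a : ℚ) ^ 2) ^ 2 := by positivity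
    have h2 : 0 ≤ (b : ℚ) ^ 2 * (-x) := mul_nonneg (by positivity) (by linarith)
    linarith
  · have h1 : 2 * a * x ≤ x ^ 2 + (a : ℚ) ^ 2 := by nlinarith [sq_nonneg (x - a)]
    have h2 : 2 * a * x * (a : ℚ) ^ 2 ≤ (x ^ 2 + (a : ℚ) ^ 2) ^ 2 := by
      rw [sq (x ^ 2 + (a : ℚ) ^ 2)]
      exact mul_le_mul h1 (by nlinarith) (by positivity) (by positivity)
    have h3 : 2 * 2 * x * (a : ℚ) ^ 2 ≤ 2 * a * x * (a : ℚ) ^ 2 := by gcongr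
    have h4 : 0 ≤ (b : ℚ) ^ 2 * x := by positivity
    rw [hq] at h2 h3 ⊢
    nlinarith

theorem not_double_of_padicNorm_le {a b : ℕ} (hab : Admissible a b) {x y : ℚ}
    {h : (curveE a b).toAffine.Nonsingular x y} (hx : padicNorm 3 x ≤ 1)
    (R : (curveE a b).toAffine.Point) : R + R ≠ Point.some x y h := by
  intro e
  have hR : R ≠ 0 := by
    rintro rfl
    exact Point.some_ne_zero h (e.symm.trans (add_zero 0))
  obtain ⟨x', y', h', e', hx'⟩ := hab.reducesToOrigin_double hR
  have := (Point.some.inj (e.symm.trans e')).1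
  subst this
  linarith

theorem not_double_of_nonpos {a b : ℕ} (hab : Admissible a b) (hp : a ^ 2 = 3 * b ^ 2 + 1)
    (ha : 2 ≤ a) {x y : ℚ} {h : (curveE a b).toAffine.Nonsingular x y} (hx : x ≤ 0)
    (R : (curveE a b).toAffine.Point) : R + R ≠ Point.some x y h := by
  intro e
  rcases R with _ | ⟨x', y', h'⟩
  · exact Point.some_ne_zero h (e.symm.trans (add_zero 0))
  · have hy := hab.y_ne_zero h'
    obtain ⟨h'', e'⟩ := curveE_double h' hy rfl rfl rfl
    have := (Point.some.inj (e.symm.trans e')).1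
    have hpos := double_x_pos hp ha hy (curveE_equation_iff.1 h'.1)
    linarith

theorem Admissible.linearIndependent {a b : ℕ} (hab : Admissible a b)
    (hp : a ^ 2 = 3 * b ^ 2 + 1) (h₁ : (curveE a b).toAffine.Nonsingular 0 (b : ℚ))
    (h₂ : (curveE a b).toAffine.Nonsingular (a : ℚ) (b : ℚ))
    (h₃ : (curveE a b).toAffine.Nonsingular (-1) (2 * (b : ℚ))) :
    LinearIndependent ℤ
      (![.some 0 (b : ℚ) h₁, .some (a : ℚ) (b : ℚ) h₂, .some (-1) (2 * (b : ℚ)) h₃] :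
        Fin 3 → (curveE a b).toAffine.Point) := by
  have hmod := mod_three_of_admissible_pell hab hp
  have hq : (a : ℚ) ^ 2 = 3 * b ^ 2 + 1 := by exact_mod_cast hp
  have ha2 : (2 : ℚ) ≤ a := by exact_mod_cast (by omega : 2 ≤ a)
  have ha0 : (a : ℚ) ≠ 0 := by positivity
  have ha1 : (a : ℚ) - 1 ≠ 0 := by linarith
  have ha1' : (a : ℚ) + 1 ≠ 0 := by positivity
  have hanorm : padicNorm 3 (a : ℚ) ≤ 1 := padicNorm.of_nat a
  -- the sums of the points: all but `P₂ + P₃` have an `x`-coordinate that is integral at `3`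
  obtain ⟨h₁₂, e₁₂⟩ := curveE_add_of_X_ne h₁ h₂ ha0.symm (x := -a) (y := -b)
    (by simp) (by simp)
  obtain ⟨h₁₃, e₁₃⟩ := curveE_add_of_X_ne h₁ h₃ (by norm_num) (x := b ^ 2 + 1)
    (by ring) rfl
  obtain ⟨h₂₃, e₂₃⟩ := curveE_add_of_X_ne h₂ h₃ (by linarith)
    (x := -(((a : ℚ) - 1) * (3 * a + 2) / (3 * (a + 1))))
    (by rw [sub_neg_eq_add]; field_simp; linear_combination (-1 - (a : ℚ)) * hq) rfl
  obtain ⟨h₁₂₃, e₁₂₃⟩ := curveE_add_of_X_ne h₁₂ h₃ (by intro h; apply ha1; linarith)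
    (x := ((a : ℚ) + 1) * (a + 2) / (a - 1))
    (by
      rw [show -(a : ℚ) - -1 = -(a - 1) by ring]
      field_simp
      linear_combination (-3) * hq) rfl
  have hnorm : padicNorm 3 (((a : ℚ) + 1) * (a + 2) / (a - 1)) ≤ 1 := by
    have hden : padicNorm 3 ((a : ℚ) - 1) = 1 := by
      have := (padicNorm.int_eq_one_iff (p := 3) ((a : ℤ) - 1)).2 (by omega)
      exact_mod_cast this
    rw [padicNorm.div, hden, div_one]
    have := padicNorm.of_nat (p := 3) ((a + 1) * (a + 2))
    exact_mod_cast this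
  have hb2 : padicNorm 3 ((b : ℚ) ^ 2 + 1) ≤ 1 := by
    have := padicNorm.of_nat (p := 3) (b ^ 2 + 1)
    exact_mod_cast this
  refine linearIndependent_int_three_of_not_double (fun P => hab.eq_zero_of_add_self P)
    (not_double_of_padicNorm_le hab (by simp)) (not_double_of_padicNorm_le hab hanorm)
    (not_double_of_padicNorm_le hab (by simp)) ?_ ?_ ?_ ?_
  · rw [e₁₂]
    exact not_double_of_padicNorm_le hab (by simpa using hanorm)
  · rw [e₁₃]
    exact not_double_of_padicNorm_le hab hb2
  -- `P₂ + P₃` does reduce to the origin modulo `3`, but its `x`-coordinate is negative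
  · rw [e₂₃]
    refine not_double_of_nonpos hab hp (by omega) ?_
    have : 0 ≤ ((a : ℚ) - 1) * (3 * a + 2) / (3 * (a + 1)) :=
      div_nonneg (mul_nonneg (by linarith) (by positivity)) (by positivity)
    linarith
  · rw [e₁₂, e₁₂₃]
    exact not_double_of_padicNorm_le hab hnorm

theorem theorem1p1 :
    -- the curve is elliptic and has trivial rational torsion for all admissible pairs
    (∀ a b : ℕ, Admissible a b →
      (curveE a b).IsElliptic ∧
      AddCommGroup.torsion (curveE a b).toAffine.Point = ⊥) ∧
    -- infinitely many admissible pairs lie on the Pell conic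
    {p : ℕ × ℕ | Admissible p.1 p.2 ∧ p.1 ^ 2 = 3 * p.2 ^ 2 + 1}.Infinite ∧
    -- for each of them the three points are independent, and the rank is at least three
    (∀ a b : ℕ, Admissible a b → a ^ 2 = 3 * b ^ 2 + 1 →
      (∃ (h₁ : (curveE a b).toAffine.Nonsingular 0 (b : ℚ))
         (h₂ : (curveE a b).toAffine.Nonsingular (a : ℚ) (b : ℚ))
         (h₃ : (curveE a b).toAffine.Nonsingular (-1) (2 * (b : ℚ))),
        LinearIndependent ℤ
          (![.some 0 (b : ℚ) h₁, .some (a : ℚ) (b : ℚ) h₂, .some (-1) (2 * (b : ℚ)) h₃] :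
            Fin 3 → (curveE a b).toAffine.Point)) ∧
      3 ≤ Module.rank ℤ (curveE a b).toAffine.Point) ∧
    -- these pairs are exactly the ones given by the powers `(2 + √3) ^ (3 + 6ℓ)`, and every
    -- such power gives a pair
    (∀ a b : ℕ, (Admissible a b ∧ a ^ 2 = 3 * b ^ 2 + 1) ↔
      ∃ l : ℕ, (2 + Real.sqrt 3) ^ (3 + 6 * l) = (a : ℝ) + (b : ℝ) * Real.sqrt 3) ∧
    (∀ l : ℕ, ∃ a b : ℕ,
      (2 + Real.sqrt 3) ^ (3 + 6 * l) = (a : ℝ) + (b : ℝ) * Real.sqrt 3) := by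
  refine ⟨fun a b hab => ⟨hab.isElliptic, hab.torsion_eq_bot⟩, infinite_admissible_pell,
    fun a b hab hp => ?_, fun a b => ?_, fun l => ⟨_, _, two_add_sqrt_three_pow _⟩⟩
  · have hq : (a : ℚ) ^ 2 = 3 * b ^ 2 + 1 := by exact_mod_cast hp
    have h₁ := hab.nonsingular (x := 0) (y := b) (by ring)
    have h₂ := hab.nonsingular (x := a) (y := b) (by ring)
    have h₃ := hab.nonsingular (x := -1) (y := 2 * b) (by linear_combination -hq)
    have hli := hab.linearIndependent hp h₁ h₂ h₃
    exact ⟨⟨h₁, h₂, h₃, hli⟩, by simpa using hli.cardinal_le_rank⟩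
  · rw [admissible_pell_iff]
    refine exists_congr fun l => ?_
    rw [two_add_sqrt_three_pow]
    constructor
    · rintro ⟨rfl, rfl⟩
      rfl
    · intro h
      obtain ⟨ha, hb⟩ := natCast_add_mul_sqrt_three_inj h
      exact ⟨ha.symm, hb.symm⟩
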